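/- Let $\beta\in\mathbb R$ and consider on $\mathbb R^3$ the Rabinovich system $\dot u=X(u)$, $u=(x,y,z)$, $$X(u)=\big(yz+\beta y,\;-xz+\beta x,\;xy\big),\qquad H_\beta(u)=\tfrac14(x^2+y^2)-\beta z,\qquad C(u)=\tfrac12(-x^2+y^2)+z^2 .$$ Let $V\subset\mathbb R^3$ be the open complement of the set of equilibria $\{(x,0,\beta)\}\cup\{(0,y,-\beta)\}\cup\{(0,0,z)\}$, and put $$P(u)=\big(xy^2+2xz^2-2\beta xz,\;yx^2+2yz^2+2\beta yz,\;-\beta x^2+zx^2-\beta y^2-y^2z\big),$$ $$Q(u)=\big(x\beta^2-xz\beta+\tfrac12xy^2,\;-yz\beta-\beta^2y-\tfrac12x^2y,\;\tfrac12(\beta x^2-zx^2-\beta y^2-y^2z)\big).$$ Definitions. Let $\Gamma=\{\gamma(t):0\le t\le T\}$ be a non-constant $T$-periodic orbit of a smooth vector field on $V$, let $M\subseteq\mathbb R^3$, and let $x(t;x_0)$ be the solution in $V$ with $x(0;x_0)=x_0$. $\Gamma$ is *orbitally stable along $M$* if for every $\varepsilon>0$ there is $\delta>0$ such that for every $x_0\in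 V\cap M$ with $\operatorname{dist}(x_0,\Gamma)<\delta$ the solution exists for all $t\ge 0$ and $\operatorname{dist}(x(t;x_0),\Gamma)<\varepsilon$ for all $t>0$; otherwise it is *unstable along $M$*. It is *orbitally phase asymptotically stable along $M$* if it is orbitally stable along $M$ and there is $\delta>0$ such that for every $x_0\in V\cap M$ with $\operatorname{dist}(x_0,\Gamma)<\delta$ the solution exists for all $t\ge0$, $\operatorname{dist}(x(t;x_0),\Gamma)\to0$, and $\lim_{t\to\infty}\|x(t;x_0)-\gamma(t+\theta_0)\|=0$ for some $\theta_0=\theta_0(x_0)\in\mathbb R$. For $M=\mathbb R^3$ one says "in $V$" instead of "along $M$". Theorem. Let $(h,c)\in\mathbb R^2$ and let $\Gamma\subseteq(H_\beta,C)^{-1}(\{(h,c)\})$ be a (non-constant) periodic orbit of the Rabinovich system. Then $\Gamma$, with the same parametrization, is a periodic orbit in $V$ of each system on $V$ below, and: 1. For every smooth $a\in C^\infty(V,(0,\infty))$, $C$ is a constant of motion of each of the two systems $\dot u=X(u)\mp a(u)\,(H_\beta(u)-h)\,P(u)$, $u\in V$. (a) For the sign $-$, $\Gamma$ is orbitally phase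 asymptotically stable along the invariant set $C^{-1}(\{c\})$. (b) For the sign $+$, $\Gamma$ is unstable, both along $C^{-1}(\{c\})$ and in $V$. 2. For every smooth $a\in C^\infty(V,(0,\infty))$, $H_\beta$ is a constant of motion of each of the two systems $\dot u=X(u)\pm a(u)\,(C(u)-c)\,Q(u)$, $u\in V$. (a) For the sign $+$, $\Gamma$ is orbitally phase asymptotically stable along the invariant set $H_\beta^{-1}(\{h\})$. (b) For the sign $-$, $\Gamma$ is unstable, both along $H_\beta^{-1}(\{h\})$ and in $V$. 3. For all smooth $a,b\in C^\infty(V,(0,\infty))$, $\Gamma$ is orbitally phase asymptotically stable in $V$ for the system $\dot u=X(u)-a(u)(H_\beta(u)-h)P(u)+b(u)(C(u)-c)Q(u)$, $u\in V$. -/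

import Mathlib

open scoped ContDiff

section PeriodicOrbits

variable {E : Type*} [NormedAddCommGroup E] [NormedSpace ℝ E]

/-- `x` is a solution, defined for all `t ≥ 0` and with values in `U`, of the initial value
problem `dx/dt = X(x)`, `x(0) = x₀`. On an open set `U` with `X` smooth it is unique, so it is the
forward trajectory `t ↦ x(t; x₀)`. -/
def IsForwardSolution (X : E → E) (U : Set E) (x₀ : E) (x : ℝ → E) : Prop :=
  x 0 = x₀ ∧ ∀ t, 0 ≤ t → x t ∈ U ∧ HasDerivWithinAt x (X (x t)) (Set.Ici 0) t

/-- `Γ = {γ(t) : 0 ≤ t ≤ T}` is a (non-constant) `T`-periodic orbit in `U` of `dx/dt = X(x)`.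
The number `T` is a period, not necessarily the least one. -/
structure IsPeriodicOrbit (X : E → E) (U : Set E) (γ : ℝ → E) (T : ℝ) (Γ : Set E) : Prop where
  period_pos : 0 < T
  periodic : ∀ t, γ (t + T) = γ t
  mem : ∀ t, γ t ∈ U
  solution : ∀ t, HasDerivAt γ (X (γ t)) t
  nonconstant : ∃ t, γ t ≠ γ 0
  orbit_eq : Γ = γ '' Set.Icc 0 T

/-- Orbital stability of `Γ` for `dx/dt = X(x)`, `x ∈ U`, with respect to initial conditions in
`U ∩ M`. For `M = Set.univ` this is orbital stability in `U`; for an invariant set `M` it is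
orbital stability along `M`. -/
def OrbitallyStable (X : E → E) (U M : Set E) (Γ : Set E) : Prop :=
  ∀ ε > 0, ∃ δ > 0, ∀ x₀ ∈ U ∩ M, Metric.infDist x₀ Γ < δ →
    ∃ x, IsForwardSolution X U x₀ x ∧ ∀ t > 0, Metric.infDist (x t) Γ < ε

/-- `Γ` is unstable: it is not orbitally stable. -/
def OrbitallyUnstable (X : E → E) (U M : Set E) (Γ : Set E) : Prop :=
  ¬ OrbitallyStable X U M Γ

/-- Orbital asymptotic stability of `Γ`. -/
def OrbitallyAsymptoticallyStable (X : E → E) (U M : Set E) (Γ : Set E) : Prop :=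
  OrbitallyStable X U M Γ ∧
    ∃ δ > 0, ∀ x₀ ∈ U ∩ M, Metric.infDist x₀ Γ < δ →
      ∃ x, IsForwardSolution X U x₀ x ∧
        Filter.Tendsto (fun t => Metric.infDist (x t) Γ) Filter.atTop (nhds 0)

/-- Orbital phase asymptotic stability of the orbit `Γ` parametrized by `γ`. -/
def OrbitallyPhaseAsymptoticallyStable (X : E → E) (U M : Set E) (γ : ℝ → E) (Γ : Set E) : Prop :=
  OrbitallyAsymptoticallyStable X U M Γ ∧
    ∃ δ > 0, ∀ x₀ ∈ U ∩ M, Metric.infDist x₀ Γ < δ →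
      ∃ x, IsForwardSolution X U x₀ x ∧ ∃ θ₀ : ℝ,
        Filter.Tendsto (fun t => ‖x t - γ (t + θ₀)‖) Filter.atTop (nhds 0)

/-- `F` is constant along every solution of `dx/dt = X(x)` that is defined on an interval `I` and
takes values in `U`. In particular every level set of `F` in `U` is invariant. -/
def IsConstantOfMotion (X : E → E) (U : Set E) (F : E → ℝ) : Prop :=
  ∀ (I : Set ℝ) (x : ℝ → E), I.OrdConnected →
    (∀ t ∈ I, x t ∈ U ∧ HasDerivWithinAt x (X (x t)) I t) →
      ∀ s ∈ I, ∀ t ∈ I, F (x s) = F (x t)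

end PeriodicOrbits

noncomputable section

namespace Rabinovich

/-- Euclidean three-space; the coordinates `(x, y, z)` of `u` are `u 0, u 1, u 2`. -/
abbrev Space := EuclideanSpace ℝ (Fin 3)

/-- The Rabinovich vector field. -/
def field (β : ℝ) (u : Space) : Space :=
  !₂[u 1 * u 2 + β * u 1, -(u 0 * u 2) + β * u 0, u 0 * u 1]

/-- The Hamiltonian `H_β`. -/
def H (β : ℝ) (u : Space) : ℝ := (u 0 ^ 2 + u 1 ^ 2) / 4 - β * u 2

/-- The Casimir `C`. -/
def C (u : Space) : ℝ := (-u 0 ^ 2 + u 1 ^ 2) / 2 + u 2 ^ 2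

/-- The open set `V`: the complement of the three lines of equilibria. -/
def V (β : ℝ) : Set Space :=
  ({u | u 1 = 0 ∧ u 2 = β} ∪ {u | u 0 = 0 ∧ u 2 = -β} ∪ {u | u 0 = 0 ∧ u 1 = 0})ᶜ

/-- The vector field `∇C × (∇H_β × ∇C)`, written out. -/
def fieldC (β : ℝ) (u : Space) : Space :=
  !₂[u 0 * u 1 ^ 2 + 2 * u 0 * u 2 ^ 2 - 2 * β * u 0 * u 2,
     u 1 * u 0 ^ 2 + 2 * u 1 * u 2 ^ 2 + 2 * β * u 1 * u 2,
     -β * u 0 ^ 2 + u 2 * u 0 ^ 2 - β * u 1 ^ 2 - u 1 ^ 2 * u 2]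

/-- The vector field `∇H_β × (∇H_β × ∇C)`, written out. -/
def fieldH (β : ℝ) (u : Space) : Space :=
  !₂[u 0 * β ^ 2 - u 0 * u 2 * β + u 0 * u 1 ^ 2 / 2,
     -(u 1 * u 2 * β) - β ^ 2 * u 1 - u 0 ^ 2 * u 1 / 2,
     (β * u 0 ^ 2 - u 2 * u 0 ^ 2 - β * u 1 ^ 2 - u 1 ^ 2 * u 2) / 2]

/-- `f ∈ C^∞(V, (0, ∞))`; values of `f` outside `V` play no role. -/
def SmoothPos (β : ℝ) (f : Space → ℝ) : Prop :=
  ContDiffOn ℝ ∞ f (V β) ∧ ∀ u ∈ V β, 0 < f u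

/-- First perturbation keeping `C` invariant (sign `-`). -/
def perturbCMinus (β h : ℝ) (a : Space → ℝ) (u : Space) : Space :=
  field β u - (a u * (H β u - h)) • fieldC β u

/-- Second perturbation keeping `C` invariant (sign `+`). -/
def perturbCPlus (β h : ℝ) (a : Space → ℝ) (u : Space) : Space :=
  field β u + (a u * (H β u - h)) • fieldC β u

/-- First perturbation keeping `H_β` invariant (sign `+`). -/
def perturbHPlus (β c : ℝ) (a : Space → ℝ) (u : Space) : Space :=
  field β u + (a u * (C u - c)) • fieldH β u

/-- Second perturbation keeping `H_β` invariant (sign `-`). -/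
def perturbHMinus (β c : ℝ) (a : Space → ℝ) (u : Space) : Space :=
  field β u - (a u * (C u - c)) • fieldH β u

/-- The two-function perturbation, which need not keep `H_β` or `C` invariant. -/
def perturbBoth (β h c : ℝ) (a b : Space → ℝ) (u : Space) : Space :=
  field β u - (a u * (H β u - h)) • fieldC β u + (b u * (C u - c)) • fieldH β u

end Rabinovich

end

/-! The Rabinovich field is X = ∇H × ∇C, so it is orthogonal to both gradients, while P = ∇C × X and
Q = ∇H × X satisfy ∇C·P = 0, ∇H·P = |X|², ∇H·Q = 0, ∇C·Q = -|X|². Along the two-function system this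
gives (H - h)' = -a|X|²(H - h) and (C - c)' = -b|X|²(C - c). Since X does not vanish on V, both
errors decay exponentially in a compact tube around Γ; with a sign reversed, the corresponding error
grows exponentially.

Three facts turn this into statements about orbits. Near Γ the distance to Γ is at most a constant
times |H - h| + |C - c| (`IsPeriodicOrbit.exists_dist_le_integrals`), because ∇H and ∇C are
independent there; with the decay this gives stability and attraction. Exponential convergence to Γ
together with an exponentially small perturbation of X forces a limiting phase
(`exists_asymptotic_phase`). Growth contradicts boundedness in the tube as soon as one error is
nonzero initially (`OrbitallyUnstable.of_hasDerivWithinAt`), and such initial points are found on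
the level set by flowing along P or Q. -/

open Set Filter Topology Metric
open scoped ContDiff NNReal Manifold

/-! ### General tools: global solutions, cutoffs, asymptotic phase, decay and growth. -/

section GeneralODE

variable {E : Type*} [NormedAddCommGroup E] [NormedSpace ℝ E]

/-- A bound L on the field keeps a solution within L * n of its start on [-n, n], so Picard–Lindelöf
applies on every such interval, and uniqueness glues the pieces. -/
theorem exists_hasDerivAt_of_lipschitzWith_of_bounded [CompleteSpace E] {v : E → E} {K L : ℝ≥0}
    (hv : LipschitzWith K v) (hL : ∀ x, ‖v x‖ ≤ L) (x₀ : E) :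
    ∃ x : ℝ → E, x 0 = x₀ ∧ ∀ t, HasDerivAt x (v (x t)) t := by
  have hloc : ∀ n : ℕ, ∃ x : ℝ → E, x 0 = x₀ ∧
      ∀ t ∈ Ioo (-(n : ℝ)) n, HasDerivAt x (v (x t)) t := by
    intro n
    have h0 : (0 : ℝ) ∈ Icc (-(n : ℝ)) n := by simp
    have hpl : IsPicardLindelof (fun _ => v) (⟨0, h0⟩ : Icc (-(n : ℝ)) n) x₀ (L * n) 0 L K :=
      .of_time_independent (fun x _ => hL x) hv.lipschitzOnWith (by simp)
    obtain ⟨x, hx0, hx⟩ := hpl.exists_eq_forall_mem_Icc_hasDerivWithinAt₀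
    exact ⟨x, hx0, fun t ht =>
      (hx t (Ioo_subset_Icc_self ht)).hasDerivAt (Icc_mem_nhds ht.1 ht.2)⟩
  choose α hα0 hα using hloc
  have heq : ∀ m n : ℕ, 0 < m → m ≤ n → EqOn (α m) (α n) (Ioo (-(m : ℝ)) m) := by
    intro m n hm hmn
    have hmn' : (m : ℝ) ≤ n := by exact_mod_cast hmn
    have hm' : (0 : ℝ) < m := by exact_mod_cast hm
    refine ODE_solution_unique_of_mem_Ioo (v := fun _ => v) (s := fun _ => univ) (t₀ := 0)
      (fun _ _ => hv.lipschitzOnWith) ⟨by linarith, hm'⟩ (fun t ht => ⟨hα m t ht, trivial⟩)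
      (fun t ht => ⟨hα n t ⟨by linarith [ht.1], by linarith [ht.2]⟩, trivial⟩) ?_
    rw [hα0, hα0]
  have hx : ∀ n : ℕ, ∀ t ∈ Ioo (-(n : ℝ)) n, α (⌊|t|⌋₊ + 1) t = α n t := by
    intro n t ht
    have habs : |t| < n := abs_lt.2 ht
    refine heq _ n (Nat.succ_pos _) ?_ ?_
    · exact Nat.succ_le_of_lt ((Nat.floor_lt (abs_nonneg t)).2 habs)
    · rw [mem_Ioo, ← abs_lt]
      push_cast
      exact Nat.lt_floor_add_one _
  -- The index `⌊|t|⌋₊ + 1` is a natural number strictly above |t|, so t is interior to the interval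
  -- of the chosen piece.
  refine ⟨fun t => α (⌊|t|⌋₊ + 1) t, hα0 _, fun t => ?_⟩
  obtain ⟨n, hn⟩ := exists_nat_gt |t|
  have ht : t ∈ Ioo (-(n : ℝ)) n := abs_lt.1 hn
  have h1 := hα n t ht
  rw [← hx n t ht] at h1
  refine h1.congr_of_eventuallyEq ?_
  filter_upwards [Ioo_mem_nhds ht.1 ht.2] with s hs using hx n s hs

theorem exists_contDiff_cutoff [FiniteDimensional ℝ E] {s u : Set E} (hs : IsCompact s)
    (hu : IsOpen u) (hsu : s ⊆ u) :
    ∃ φ : E → ℝ, ContDiff ℝ ∞ φ ∧ HasCompactSupport φ ∧ tsupport φ ⊆ u ∧ (∀ x ∈ s, φ x = 1) ∧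
      ∀ x, 0 ≤ φ x := by
  have := FiniteDimensional.proper_real E
  obtain ⟨k, hk, hsk, hku⟩ := exists_compact_between hs hu hsu
  obtain ⟨f, hf1, hf0, hf⟩ :=
    exists_contMDiffMap_one_nhds_of_subset_interior (n := (⊤ : ℕ∞)) 𝓘(ℝ, E) hs.isClosed hsk
  have hsupp : tsupport f ⊆ k := by
    refine closure_minimal (fun x hx => ?_) hk.isClosed
    by_contra hxk
    exact hx (hf0 x hxk)
  exact ⟨f, f.contMDiff.contDiff, hk.of_isClosed_subset (isClosed_tsupport _) hsupp,
    hsupp.trans hku, fun x hx => hf1.self_of_nhdsSet x hx, fun x => (hf x).1⟩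

theorem ContDiffOn.contDiff_smul_cutoff {F : Type*} [NormedAddCommGroup F] [NormedSpace ℝ F]
    {φ : E → ℝ} {v : E → F} {u : Set E} {n : WithTop ℕ∞}
    (hv : ContDiffOn ℝ n v u) (hu : IsOpen u) (hφ : ContDiff ℝ n φ) (hφu : tsupport φ ⊆ u) :
    ContDiff ℝ n fun x => φ x • v x := by
  rw [contDiff_iff_contDiffAt]
  intro x
  by_cases hx : x ∈ tsupport φ
  · exact hφ.contDiffAt.smul (hv.contDiffAt (hu.mem_nhds (hφu hx)))
  · have : (fun x => φ x • v x) =ᶠ[𝓝 x] fun _ => 0 := by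
      filter_upwards [notMem_tsupport_iff_eventuallyEq.1 hx] with y hy
      simp [hy]
    exact contDiffAt_const.congr_of_eventuallyEq this

/-- Grönwall's inequality in a crude form: K ≥ 1 allows ε / K to be replaced by ε. The shift c lets
the comparison orbit start at any phase. -/
theorem dist_le_of_perturbed_trajectory {v : E → E} {K : ℝ≥0} (hK : 1 ≤ K)
    (hv : LipschitzWith K v) {x x' γ : ℝ → E} {a b δ ε : ℝ} (hδ : 0 ≤ δ) (hε : 0 ≤ ε)
    (hx : ∀ t ∈ Icc a b, HasDerivAt x (x' t) t) (hxv : ∀ t ∈ Icc a b, dist (x' t) (v (x t)) ≤ ε)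
    (hγ : ∀ t, HasDerivAt γ (v (γ t)) t) {c : ℝ} (h0 : dist (x a) (γ (a + c)) ≤ δ) :
    ∀ t ∈ Icc a b, dist (x t) (γ (t + c)) ≤ (δ + ε) * Real.exp (K * (b - a)) := by
  intro t ht
  have h := dist_le_of_approx_trajectories_ODE (v := fun _ => v) (fun _ => hv)
    (f := x) (g := fun t => γ (t + c)) (f' := x') (g' := fun t => v (γ (t + c)))
    (εf := ε) (εg := 0) (δ := δ)
    (fun s hs => (hx s hs).continuousAt.continuousWithinAt)
    (fun s hs => (hx s (Ico_subset_Icc_self hs)).hasDerivWithinAt)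
    (fun s hs => hxv s (Ico_subset_Icc_self hs))
    (fun s _ => ((hγ (s + c)).comp_add_const s c).continuousAt.continuousWithinAt)
    (fun s _ => ((hγ (s + c)).comp_add_const s c).hasDerivWithinAt)
    (fun s _ => by simp) h0 t ht
  have hK' : (1 : ℝ) ≤ K := by exact_mod_cast hK
  refine h.trans ?_
  rw [gronwallBound_of_K_ne_0 (by positivity)]
  have h1 : Real.exp (K * (t - a)) ≤ Real.exp (K * (b - a)) :=
    Real.exp_le_exp.2 (mul_le_mul_of_nonneg_left (by linarith [ht.2]) (by positivity))
  have h2 : (1 : ℝ) ≤ Real.exp (K * (t - a)) :=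
    Real.one_le_exp (mul_nonneg (by positivity) (by linarith [ht.1]))
  have h3 : (ε + 0) / K ≤ ε := by
    rw [add_zero]; exact div_le_self hε hK'
  calc δ * Real.exp (K * (t - a)) + (ε + 0) / K * (Real.exp (K * (t - a)) - 1)
      ≤ δ * Real.exp (K * (b - a)) + ε * Real.exp (K * (b - a)) := by
        refine add_le_add (mul_le_mul_of_nonneg_left h1 hδ)
          (mul_le_mul h3 (by linarith) (by linarith) hε)
    _ = _ := by ring

theorem Function.Periodic.isCompact_range_of_continuous {Y : Type*} [TopologicalSpace Y]
    {γ : ℝ → Y} {T : ℝ} (hT : 0 < T)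
    (hper : Function.Periodic γ T) (hγ : Continuous γ) : IsCompact (range γ) := by
  rw [← hper.image_Icc hT 0]
  exact isCompact_Icc.image hγ

/-- Sample x at the multiples of T. Over one period the nearby orbit point returns to itself while x
follows it up to an error of order ρ ^ n, so consecutive samples differ by a geometric term. They
converge to a point γ θ of the closed orbit, and Grönwall carries this convergence through each
period. -/
theorem exists_asymptotic_phase [CompleteSpace E] {v : E → E} {K : ℝ≥0}
    (hv : LipschitzWith K v) {x x' γ : ℝ → E} {T A l : ℝ} (hT : 0 < T) (hl : 0 < l)
    (hper : Function.Periodic γ T) (hγ : ∀ t, HasDerivAt γ (v (γ t)) t)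
    (hx : ∀ t ≥ 0, HasDerivAt x (x' t) t)
    (hxv : ∀ t ≥ 0, dist (x' t) (v (x t)) ≤ A * Real.exp (-l * t))
    (hdist : ∀ t ≥ 0, ∃ s, dist (x t) (γ s) ≤ A * Real.exp (-l * t)) :
    ∃ θ, Tendsto (fun t => ‖x t - γ (t + θ)‖) atTop (𝓝 0) := by
  have hA : 0 ≤ A := by
    obtain ⟨s, hs⟩ := hdist 0 le_rfl
    simpa using dist_nonneg.trans hs
  set ρ := Real.exp (-l * T) with hρ
  have hρ0 : 0 ≤ ρ := (Real.exp_pos _).le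
  have hρ1 : ρ < 1 := by
    rw [hρ, Real.exp_lt_one_iff]; nlinarith
  set D := Real.exp ((K + 1 : ℝ≥0) * T) with hD
  have hpow : ∀ n : ℕ, Real.exp (-l * (n * T)) = ρ ^ n := by
    intro n
    rw [hρ, ← Real.exp_nat_mul]; ring_nf
  have hstep : ∀ (n : ℕ) (s δ : ℝ), dist (x (n * T)) (γ s) ≤ δ → ∀ τ ∈ Icc 0 T,
      dist (x (n * T + τ)) (γ (s + τ)) ≤ (δ + A * ρ ^ n) * D := by
    intro n s δ hs τ hτ
    have hn : 0 ≤ n * T := by positivity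
    -- The constant K + 1 meets the requirement of being at least 1; on this period the perturbation
    -- is largest at its start, where it is at most A * ρ ^ n.
    have := dist_le_of_perturbed_trajectory (K := K + 1) (by simp)
      (hv.weaken (by simp)) (a := n * T) (b := n * T + T) (δ := δ) (ε := A * ρ ^ n)
      (c := s - n * T) (dist_nonneg.trans hs) (by positivity)
      (fun t ht => hx t (hn.trans ht.1)) (fun t ht => (hxv t (hn.trans ht.1)).trans ?_) hγ
      (by simpa using hs) (n * T + τ) ⟨by linarith [hτ.1], by linarith [hτ.2]⟩
    · convert this using 3
      · ring_nf
      · ring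
    · rw [← hpow]
      refine mul_le_mul_of_nonneg_left (Real.exp_le_exp.2 ?_) hA
      nlinarith [ht.1]
  choose! s hs using hdist
  have hsn : ∀ n : ℕ, dist (x (n * T)) (γ (s (n * T))) ≤ A * ρ ^ n := fun n => by
    rw [← hpow]; exact hs _ (by positivity)
  have hcauchy : CauchySeq fun n : ℕ => x (n * T) := by
    refine cauchySeq_of_le_geometric ρ (A + (A + A) * D) hρ1 fun n => ?_
    have h1 := hstep n _ _ (hsn n) T ⟨hT.le, le_rfl⟩
    rw [hper] at h1
    have h2 := dist_triangle_right (x (n * T)) (x (n * T + T)) (γ (s (n * T)))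
    have h3 : ((n + 1 : ℕ) : ℝ) * T = n * T + T := by push_cast; ring
    rw [h3]
    nlinarith [hsn n]
  obtain ⟨p, hp⟩ := cauchySeq_tendsto_of_complete hcauchy
  have hρn : Tendsto (fun n : ℕ => A * ρ ^ n) atTop (𝓝 0) := by
    simpa using (tendsto_pow_atTop_nhds_zero_of_lt_one hρ0 hρ1).const_mul A
  have hp' : Tendsto (fun n : ℕ => γ (s (n * T))) atTop (𝓝 p) := by
    refine (tendsto_iff_of_dist ?_).1 hp
    exact squeeze_zero (fun _ => dist_nonneg) hsn hρn
  have hcont : Continuous γ := continuous_iff_continuousAt.2 fun t => (hγ t).continuousAt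
  obtain ⟨θ, rfl⟩ : p ∈ range γ :=
    (hper.isCompact_range_of_continuous hT hcont).isClosed.mem_of_tendsto hp'
      (Eventually.of_forall fun n => mem_range_self _)
  refine ⟨θ, ?_⟩
  have hlim : Tendsto (fun n : ℕ => (dist (x (n * T)) (γ θ) + A * ρ ^ n) * D) atTop (𝓝 0) := by
    simpa using ((tendsto_iff_dist_tendsto_zero.1 hp).add hρn).mul_const D
  have hfloor : Tendsto (fun t : ℝ => ⌊t / T⌋₊) atTop atTop :=
    tendsto_nat_floor_atTop.comp (tendsto_id.atTop_div_const hT)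
  refine squeeze_zero' (Eventually.of_forall fun _ => norm_nonneg _) ?_ (hlim.comp hfloor)
  filter_upwards [eventually_ge_atTop 0] with t ht
  set n := ⌊t / T⌋₊
  have h1 : (n : ℝ) * T ≤ t := (le_div_iff₀ hT).1 (Nat.floor_le (by positivity))
  have h2 : t < (n + 1) * T := (div_lt_iff₀ hT).1 (Nat.lt_floor_add_one _)
  have h3 := hstep n θ _ le_rfl (t - n * T) ⟨by linarith, by linarith⟩
  have h4 : γ (t + θ) = γ (θ + (t - n * T)) := by
    rw [← (hper.nat_mul n) (θ + (t - n * T))]; ring_nf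
  rw [← dist_eq_norm, h4]
  simpa using h3

/-- A trajectory leaving the η-tube would pass through distance exactly η, which lies below δ and is
excluded there. -/
theorem forall_infDist_lt_of_trapping {Y : Type*} [PseudoMetricSpace Y] {Γ : Set Y}
    {x : ℝ → Y} (hx : ∀ t, ContinuousAt x t)
    {η δ : ℝ} (hηδ : η < δ) (h0 : infDist (x 0) Γ < η)
    (htrap : ∀ t ≥ 0, infDist (x t) Γ < δ → infDist (x t) Γ < η) :
    ∀ t ≥ 0, infDist (x t) Γ < η := by
  intro t ht
  by_contra! hge
  have hcont : ContinuousOn (fun s => infDist (x s) Γ) (Icc 0 t) := fun s _ =>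
    ((continuous_infDist_pt Γ).continuousAt.comp (hx s)).continuousWithinAt
  obtain ⟨s, hs, hsη⟩ := intermediate_value_Icc ht hcont ⟨h0.le, hge⟩
  have hsη' : infDist (x s) Γ = η := hsη
  have := htrap s hs.1 (by rw [hsη']; exact hηδ)
  linarith

/-- The product f² e^{2lt} is nonincreasing. The rate l may be 0, which gives plain monotonicity of
|f|. -/
theorem abs_le_abs_mul_exp_of_hasDerivAt {f μ : ℝ → ℝ} {l : ℝ}
    (hf : ∀ t ≥ 0, HasDerivAt f (-(μ t * f t)) t) (hμ : ∀ t ≥ 0, l ≤ μ t) :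
    ∀ t ≥ 0, |f t| ≤ |f 0| * Real.exp (-l * t) := by
  have hderiv : ∀ t ≥ 0, HasDerivAt (fun t => f t ^ 2 * Real.exp (2 * l * t))
      (2 * (l - μ t) * f t ^ 2 * Real.exp (2 * l * t)) t := by
    intro t ht
    have h1 := (hf t ht).pow 2
    have h2 : HasDerivAt (fun t => Real.exp (2 * l * t)) (Real.exp (2 * l * t) * (2 * l)) t := by
      simpa using ((hasDerivAt_id t).const_mul (2 * l)).exp
    refine (h1.mul h2).congr_deriv ?_
    simp only [Pi.pow_apply, Nat.cast_ofNat]; ring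
  have hanti : AntitoneOn (fun t => f t ^ 2 * Real.exp (2 * l * t)) (Ici 0) := by
    refine antitoneOn_of_hasDerivWithinAt_nonpos (convex_Ici 0)
      (fun t ht => (hderiv t ht).continuousAt.continuousWithinAt)
      (fun t ht => (hderiv t (interior_subset ht)).hasDerivWithinAt) fun t ht => ?_
    have := hμ t (interior_subset ht)
    have h3 : 0 ≤ f t ^ 2 * Real.exp (2 * l * t) := by positivity
    nlinarith
  intro t ht
  have h := hanti (mem_Ici.2 le_rfl) (mem_Ici.2 ht) ht
  refine abs_le_of_sq_le_sq' ?_ (by positivity) |> abs_le.2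
  have h4 : (|f 0| * Real.exp (-l * t)) ^ 2 = f 0 ^ 2 * Real.exp (-(2 * l * t)) := by
    rw [mul_pow, sq_abs, ← Real.exp_nat_mul]; ring_nf
  rw [h4, Real.exp_neg, ← div_eq_mul_inv, le_div_iff₀ (Real.exp_pos _)]
  simpa using h

theorem IsConstantOfMotion.of_hasDerivWithinAt {X : E → E} {U : Set E} {F : E → ℝ}
    (h : ∀ (I : Set ℝ) (x : ℝ → E), ∀ t ∈ I, x t ∈ U → HasDerivWithinAt x (X (x t)) I t →
      HasDerivWithinAt (fun t => F (x t)) 0 I t) : IsConstantOfMotion X U F := by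
  intro I x hI hx s hs t ht
  have := hI.convex.norm_image_sub_le_of_norm_hasDerivWithin_le (f := fun t => F (x t))
    (f' := fun _ => 0) (C := 0) (fun t ht => h I x t ht (hx t ht).1 (hx t ht).2) (by simp) ht hs
  simpa [sub_eq_zero] using this

/-- If `f` grows exponentially along solutions near `Γ`, and `f` takes nonzero values on `M`
arbitrarily near `Γ`, then `Γ` is unstable along `M`. -/
theorem OrbitallyUnstable.of_hasDerivWithinAt [ProperSpace E] {X : E → E} {U M Γ : Set E}
    {f μ : E → ℝ} (hΓ : IsCompact Γ) (hΓ0 : Γ.Nonempty) (hU : IsOpen U) (hΓU : Γ ⊆ U)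
    (hf : ContinuousOn f U) (hμ : ContinuousOn μ U) (hμ0 : ∀ u ∈ U, 0 < μ u)
    (hder : ∀ (x : ℝ → E) (t : ℝ), x t ∈ U → HasDerivWithinAt x (X (x t)) (Ici 0) t →
      HasDerivWithinAt (fun t => f (x t)) (μ (x t) * f (x t)) (Ici 0) t)
    (hM : ∀ δ > 0, ∃ u ∈ U ∩ M, infDist u Γ < δ ∧ f u ≠ 0) : OrbitallyUnstable X U M Γ := by
  intro hstab
  obtain ⟨r, hr, hrU⟩ := hΓ.exists_cthickening_subset_open hU hΓU
  have hne : (cthickening r Γ).Nonempty := hΓ0.mono (self_subset_cthickening Γ)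
  have hcpt : IsCompact (cthickening r Γ) := hΓ.cthickening
  obtain ⟨u₁, hu₁, hmin⟩ := hcpt.exists_isMinOn hne (hμ.mono hrU)
  have hl : 0 < μ u₁ := hμ0 _ (hrU hu₁)
  obtain ⟨B, hB⟩ := hcpt.exists_bound_of_continuousOn (hf.mono hrU)
  obtain ⟨δ, hδ, hst⟩ := hstab r hr
  obtain ⟨x₀, hx₀, hx₀δ, hfx₀⟩ := hM δ hδ
  obtain ⟨x, ⟨hx0, hx⟩, hxr⟩ := hst x₀ hx₀ hx₀δ
  set l := μ u₁
  have hmem : ∀ t > 0, x t ∈ cthickening r Γ := fun t ht =>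
    thickening_subset_cthickening _ _ ((mem_thickening_iff_infDist_lt hΓ0).2 (hxr t ht))
  have hderiv : ∀ t ≥ 0, HasDerivWithinAt (fun t => f (x t) ^ 2 * Real.exp (-(2 * l) * t))
      (2 * (μ (x t) - l) * f (x t) ^ 2 * Real.exp (-(2 * l) * t)) (Ici 0) t := by
    intro t ht
    have h1 := (hder x t (hx t ht).1 (hx t ht).2).pow 2
    have h2 : HasDerivAt (fun t => Real.exp (-(2 * l) * t))
        (Real.exp (-(2 * l) * t) * (-(2 * l))) t := by
      simpa using ((hasDerivAt_id t).const_mul (-(2 * l))).exp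
    refine (h1.mul h2.hasDerivWithinAt).congr_deriv ?_
    simp only [Pi.pow_apply, Nat.cast_ofNat]; ring
  -- Stability places the solution in the tube only for t > 0; the sign of the derivative is needed
  -- only in the interior of the half-line.
  have hmono : MonotoneOn (fun t => f (x t) ^ 2 * Real.exp (-(2 * l) * t)) (Ici 0) := by
    refine monotoneOn_of_hasDerivWithinAt_nonneg (convex_Ici 0)
      (fun t ht => (hderiv t ht).continuousWithinAt)
      (fun t ht => (hderiv t (interior_subset ht)).mono interior_subset) fun t ht => ?_
    rw [interior_Ici] at ht
    have h3 : l ≤ μ (x t) := hmin (hmem t ht)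
    have h4 : 0 ≤ μ (x t) - l := by linarith
    positivity
  have hgrow : ∀ t > 0, f x₀ ^ 2 ≤ B ^ 2 * Real.exp (-(2 * l) * t) := by
    intro t ht
    have h := hmono (mem_Ici.2 le_rfl) (mem_Ici.2 ht.le) ht.le
    have hb := hB _ (hmem t ht)
    rw [Real.norm_eq_abs] at hb
    simp only [hx0, mul_zero, Real.exp_zero, mul_one] at h
    refine h.trans (mul_le_mul_of_nonneg_right ?_ (Real.exp_pos _).le)
    rw [← sq_abs]
    exact pow_le_pow_left₀ (abs_nonneg _) hb 2
  have hlim : Tendsto (fun t : ℝ => B ^ 2 * Real.exp (-(2 * l) * t)) atTop (𝓝 (B ^ 2 * 0)) := by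
    refine Tendsto.const_mul _ (Real.tendsto_exp_atBot.comp ?_)
    exact tendsto_id.const_mul_atTop_of_neg (by linarith)
  have : f x₀ ^ 2 ≤ B ^ 2 * 0 :=
    ge_of_tendsto hlim ((eventually_gt_atTop 0).mono fun t ht => hgrow t ht)
  have : 0 < f x₀ ^ 2 := by positivity
  linarith

theorem OrbitallyUnstable.mono {X : E → E} {U M N Γ : Set E} (h : OrbitallyUnstable X U M Γ)
    (hMN : M ⊆ N) : OrbitallyUnstable X U N Γ := fun hN => h fun ε hε => by
  obtain ⟨δ, hδ, H⟩ := hN ε hε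
  exact ⟨δ, hδ, fun x hx => H x ⟨hx.1, hMN hx.2⟩⟩

end GeneralODE

/-! ### Algebra of the Rabinovich system and its moving frame. -/

namespace Rabinovich

theorem isOpen_V (β : ℝ) : IsOpen (V β) := by
  have h0 : Continuous fun u : Space => u 0 := by fun_prop
  have h1 : Continuous fun u : Space => u 1 := by fun_prop
  have h2 : Continuous fun u : Space => u 2 := by fun_prop
  refine isOpen_compl_iff.2 (((?_ : IsClosed _).union ?_).union ?_)
  · exact (isClosed_eq h1 continuous_const).inter (isClosed_eq h2 continuous_const)
  · exact (isClosed_eq h0 continuous_const).inter (isClosed_eq h2 continuous_const)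
  · exact (isClosed_eq h0 continuous_const).inter (isClosed_eq h1 continuous_const)

theorem contDiff_toLp {n : WithTop ℕ∞} {f g k : Space → ℝ} (hf : ContDiff ℝ n f)
    (hg : ContDiff ℝ n g) (hk : ContDiff ℝ n k) :
    ContDiff ℝ n fun u => (!₂[f u, g u, k u] : Space) := by
  rw [contDiff_euclidean]
  intro i
  fin_cases i
  exacts [hf, hg, hk]

theorem contDiff_field (β : ℝ) : ContDiff ℝ ∞ (field β) := by
  unfold field
  refine contDiff_toLp ?_ ?_ ?_ <;> fun_prop

theorem contDiff_fieldC (β : ℝ) : ContDiff ℝ ∞ (fieldC β) := by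
  unfold fieldC
  refine contDiff_toLp ?_ ?_ ?_ <;> fun_prop

theorem contDiff_fieldH (β : ℝ) : ContDiff ℝ ∞ (fieldH β) := by
  unfold fieldH
  refine contDiff_toLp ?_ ?_ ?_ <;> fun_prop

theorem contDiff_H (β : ℝ) : ContDiff ℝ ∞ (H β) := by
  unfold H
  fun_prop

theorem contDiff_C : ContDiff ℝ ∞ C := by
  unfold C
  fun_prop

theorem field_eq_zero_iff {β : ℝ} {u : Space} : field β u = 0 ↔ u ∉ V β := by
  have h : field β u = 0 ↔
      u 1 * u 2 + β * u 1 = 0 ∧ -(u 0 * u 2) + β * u 0 = 0 ∧ u 0 * u 1 = 0 := by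
    constructor
    · intro h
      exact ⟨by simpa [field] using congrArg (fun w : Space => w 0) h,
        by simpa [field] using congrArg (fun w : Space => w 1) h,
        by simpa [field] using congrArg (fun w : Space => w 2) h⟩
    · rintro ⟨h0, h1, h2⟩
      ext i
      fin_cases i <;> simp [field, *]
  rw [h]
  simp only [V, mem_compl_iff, not_not, mem_union, mem_ofPred_eq]
  constructor
  · rintro ⟨h0, h1, h2⟩
    rcases mul_eq_zero.1 h2 with hx | hy
    · rcases mul_eq_zero.1 (show u 1 * (u 2 + β) = 0 by linarith) with hy | hz
      · exact Or.inr ⟨hx, hy⟩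
      · exact Or.inl (Or.inr ⟨hx, by linarith⟩)
    · rcases mul_eq_zero.1 (show u 0 * (β - u 2) = 0 by linarith) with hx | hz
      · exact Or.inr ⟨hx, hy⟩
      · exact Or.inl (Or.inl ⟨hy, by linarith⟩)
  · rintro ((⟨h0, h1⟩ | ⟨h0, h1⟩) | ⟨h0, h1⟩) <;> simp [h0, h1, mul_comm β]

theorem norm_field_pos {β : ℝ} {u : Space} (hu : u ∈ V β) : 0 < ‖field β u‖ :=
  norm_pos_iff.2 fun h => field_eq_zero_iff.1 h hu

theorem norm_field_sq (β : ℝ) (u : Space) : ‖field β u‖ ^ 2 =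
    (u 1 * u 2 + β * u 1) ^ 2 + (-(u 0 * u 2) + β * u 0) ^ 2 + (u 0 * u 1) ^ 2 := by
  simp [EuclideanSpace.norm_sq_eq, Fin.sum_univ_three, field]

theorem hasDerivWithinAt_coord {x : ℝ → Space} {v : Space} {s : Set ℝ} {t : ℝ}
    (hx : HasDerivWithinAt x v s t) (i : Fin 3) :
    HasDerivWithinAt (fun t => x t i) (v i) s t :=
  (EuclideanSpace.proj (𝕜 := ℝ) i).hasFDerivAt.comp_hasDerivWithinAt t hx

theorem hasDerivWithinAt_H {β : ℝ} {x : ℝ → Space} {v : Space} {s : Set ℝ} {t : ℝ}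
    (hx : HasDerivWithinAt x v s t) : HasDerivWithinAt (fun t => H β (x t))
      (x t 0 * v 0 / 2 + x t 1 * v 1 / 2 - β * v 2) s t := by
  have h := hasDerivWithinAt_coord hx
  refine (((((h 0).fun_pow 2).fun_add ((h 1).fun_pow 2)).div_const 4).fun_sub
    ((h 2).const_mul β)).congr_deriv ?_
  simp only [Nat.cast_ofNat]; ring

theorem hasDerivWithinAt_C {x : ℝ → Space} {v : Space} {s : Set ℝ} {t : ℝ}
    (hx : HasDerivWithinAt x v s t) : HasDerivWithinAt (fun t => C (x t))
      (-(x t 0 * v 0) + x t 1 * v 1 + 2 * (x t 2 * v 2)) s t := by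
  have h := hasDerivWithinAt_coord hx
  refine (((((h 0).fun_pow 2).fun_neg.fun_add ((h 1).fun_pow 2)).div_const 2).fun_add
    ((h 2).fun_pow 2)).congr_deriv ?_
  simp only [Nat.cast_ofNat]; ring

/-- Of the frame X, P, Q, only P has a component along ∇H, and ∇H·(∇C × X) = |X|². -/
theorem hasDerivWithinAt_H_of_combination {β p q r : ℝ} {x : ℝ → Space} {s : Set ℝ} {t : ℝ}
    (hx : HasDerivWithinAt x (p • field β (x t) + q • fieldC β (x t) + r • fieldH β (x t)) s t) :
    HasDerivWithinAt (fun t => H β (x t)) (q * ‖field β (x t)‖ ^ 2) s t := by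
  refine (hasDerivWithinAt_H hx).congr_deriv ?_
  rw [norm_field_sq]
  simp [field, fieldC, fieldH]
  ring

/-- Only Q has a component along ∇C; the sign comes from ∇C·(∇H × X) = -|X|². -/
theorem hasDerivWithinAt_C_of_combination {β p q r : ℝ} {x : ℝ → Space} {s : Set ℝ} {t : ℝ}
    (hx : HasDerivWithinAt x (p • field β (x t) + q • fieldC β (x t) + r • fieldH β (x t)) s t) :
    HasDerivWithinAt (fun t => C (x t)) (-(r * ‖field β (x t)‖ ^ 2)) s t := by
  refine (hasDerivWithinAt_C hx).congr_deriv ?_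
  rw [norm_field_sq]
  simp [field, fieldC, fieldH]
  ring

theorem perturbBoth_eq (β h c : ℝ) (a b : Space → ℝ) (u : Space) :
    perturbBoth β h c a b u = (1 : ℝ) • field β u + (-(a u * (H β u - h))) • fieldC β u +
      (b u * (C u - c)) • fieldH β u := by
  simp [perturbBoth, sub_eq_add_neg]

/-- This and the next three identities make every system an instance of `perturbBoth`, with one
coefficient zero and the other possibly negated. The constant multiplying the zero coefficient is
arbitrary. -/
theorem perturbCMinus_eq_perturbBoth (β h c : ℝ) (a : Space → ℝ) :
    perturbCMinus β h a = perturbBoth β h c a 0 := by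
  funext u; simp [perturbCMinus, perturbBoth]

theorem perturbCPlus_eq_perturbBoth (β h c : ℝ) (a : Space → ℝ) :
    perturbCPlus β h a = perturbBoth β h c (-a) 0 := by
  funext u; simp [perturbCPlus, perturbBoth]

theorem perturbHPlus_eq_perturbBoth (β h c : ℝ) (b : Space → ℝ) :
    perturbHPlus β c b = perturbBoth β h c 0 b := by
  funext u; simp [perturbHPlus, perturbBoth]

theorem perturbHMinus_eq_perturbBoth (β h c : ℝ) (b : Space → ℝ) :
    perturbHMinus β c b = perturbBoth β h c 0 (-b) := by
  funext u; simp [perturbHMinus, perturbBoth, sub_eq_add_neg]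

/-- The increment `q - r` in the moving frame of the midpoint; exact because `H` and `C` are
quadratic. -/
theorem norm_field_sq_smul_sub (β : ℝ) (q r : Space) :
    ‖field β ((1 / 2 : ℝ) • (q + r))‖ ^ 2 • (q - r) =
      (inner ℝ (field β ((1 / 2 : ℝ) • (q + r))) (q - r)) • field β ((1 / 2 : ℝ) • (q + r)) +
      (H β q - H β r) • fieldC β ((1 / 2 : ℝ) • (q + r)) -
      (C q - C r) • fieldH β ((1 / 2 : ℝ) • (q + r)) := by
  rw [norm_field_sq]
  ext i
  fin_cases i <;>
  · simp [PiLp.inner_apply, Fin.sum_univ_three, field, fieldC, fieldH, H, C]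
    ring

theorem isConstantOfMotion_C (β h c : ℝ) (a : Space → ℝ) :
    IsConstantOfMotion (perturbBoth β h c a 0) (V β) C :=
  .of_hasDerivWithinAt fun _ _ _ _ _ hx => by
    rw [perturbBoth_eq] at hx
    simpa using hasDerivWithinAt_C_of_combination hx

theorem isConstantOfMotion_H (β h c : ℝ) (b : Space → ℝ) :
    IsConstantOfMotion (perturbBoth β h c 0 b) (V β) (H β) :=
  .of_hasDerivWithinAt fun _ _ _ _ _ hx => by
    rw [perturbBoth_eq] at hx
    simpa using hasDerivWithinAt_H_of_combination hx

end Rabinovich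

/-! ### Geometry of the periodic orbit and the distance estimate. -/

section Orbit

open Rabinovich

variable {β h c : ℝ} {γ : ℝ → Space} {T : ℝ} {Γ : Set Space}

theorem IsPeriodicOrbit.orbit_eq_range {E : Type*} [NormedAddCommGroup E] [NormedSpace ℝ E]
    {X : E → E} {U : Set E} {γ : ℝ → E} {T : ℝ} {Γ : Set E} (hΓ : IsPeriodicOrbit X U γ T Γ) :
    Γ = range γ := by
  have := Function.Periodic.image_Icc (f := γ) hΓ.periodic hΓ.period_pos 0
  rw [zero_add] at this
  rw [hΓ.orbit_eq, this]

theorem IsPeriodicOrbit.isCompact {E : Type*} [NormedAddCommGroup E] [NormedSpace ℝ E]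
    {X : E → E} {U : Set E} {γ : ℝ → E} {T : ℝ} {Γ : Set E} (hΓ : IsPeriodicOrbit X U γ T Γ) :
    IsCompact Γ := by
  rw [hΓ.orbit_eq]
  exact isCompact_Icc.image
    (continuous_iff_continuousAt.2 fun t => (hΓ.solution t).continuousAt)

/-- A non-constant periodic orbit contains no equilibrium. -/
theorem IsPeriodicOrbit.field_ne_zero {E : Type*} [NormedAddCommGroup E] [NormedSpace ℝ E]
    [FiniteDimensional ℝ E]
    {X : E → E} {U : Set E} {γ : ℝ → E} {T : ℝ} {Γ : Set E} (hΓ : IsPeriodicOrbit X U γ T Γ)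
    (hX : ContDiff ℝ ∞ X) (t₀ : ℝ) : X (γ t₀) ≠ 0 := by
  intro h0
  -- Cutting off near Γ makes the field globally Lipschitz without changing it on Γ, so uniqueness
  -- identifies γ with an equilibrium solution.
  obtain ⟨φ, hφ, hφc, -, hφ1, -⟩ :=
    exists_contDiff_cutoff hΓ.isCompact isOpen_univ (subset_univ Γ)
  obtain ⟨K, hK⟩ := ContDiff.lipschitzWith_of_hasCompactSupport (𝕂 := ℝ)
    (f := fun x => φ x • X x) hφc.smul_right (hφ.smul hX) (by simp)
  have hmem : ∀ t, γ t ∈ Γ := fun t => by rw [hΓ.orbit_eq_range]; exact mem_range_self t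
  have hconst : γ = fun _ => γ t₀ := by
    refine ODE_solution_unique_univ (v := fun _ x => φ x • X x) (s := fun _ => univ) (t₀ := t₀)
      (fun _ => hK.lipschitzOnWith) (fun t => ⟨?_, trivial⟩) (fun t => ⟨?_, trivial⟩) rfl
    · simpa [hφ1 _ (hmem t)] using hΓ.solution t
    · simpa [h0] using hasDerivAt_const t (γ t₀)
  obtain ⟨t, ht⟩ := hΓ.nonconstant
  rw [hconst] at ht
  exact ht rfl

theorem IsPeriodicOrbit.mem_V (hΓ : IsPeriodicOrbit (field β) univ γ T Γ) (t : ℝ) :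
    γ t ∈ V β := by
  by_contra h
  exact hΓ.field_ne_zero (contDiff_field β) t (field_eq_zero_iff.2 h)

/-- Both perturbing terms carry a factor, H - h or C - c, that vanishes on Γ. -/
theorem IsPeriodicOrbit.isPeriodicOrbit_perturbBoth (hΓ : IsPeriodicOrbit (field β) univ γ T Γ)
    (hfiber : Γ ⊆ {u | H β u = h ∧ C u = c}) (a b : Space → ℝ) :
    IsPeriodicOrbit (perturbBoth β h c a b) (V β) γ T Γ where
  period_pos := hΓ.period_pos
  periodic := hΓ.periodic
  mem := hΓ.mem_V
  nonconstant := hΓ.nonconstant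
  orbit_eq := hΓ.orbit_eq
  solution t := by
    have hmem : γ t ∈ Γ := by rw [hΓ.orbit_eq_range]; exact mem_range_self t
    have := hΓ.solution t
    simpa [perturbBoth, (hfiber hmem).1, (hfiber hmem).2] using this

/-- Near a periodic orbit, the distance to the orbit is controlled by the first integrals. -/
theorem IsPeriodicOrbit.exists_dist_le_integrals
    (hΓ : IsPeriodicOrbit (field β) univ γ T Γ)
    (hfiber : Γ ⊆ {u | H β u = h ∧ C u = c}) :
    ∃ δ > 0, ∃ A > 0, ∀ q : Space, infDist q Γ < δ →
      ∃ s, dist q (γ s) = infDist q Γ ∧ dist q (γ s) ≤ A * (|H β q - h| + |C q - c|) := by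
  have hmem : ∀ t, γ t ∈ Γ := fun t => by rw [hΓ.orbit_eq_range]; exact mem_range_self t
  have hne : Γ.Nonempty := ⟨_, hmem 0⟩
  have hΓV : Γ ⊆ V β := by
    rw [hΓ.orbit_eq_range]; exact range_subset_iff.2 hΓ.mem_V
  obtain ⟨r, hr, hrV⟩ := hΓ.isCompact.exists_cthickening_subset_open (isOpen_V β) hΓV
  have hcpt : IsCompact (cthickening r Γ) := hΓ.isCompact.cthickening
  obtain ⟨φ, hφ, hφc, -, hφ1, -⟩ := exists_contDiff_cutoff hcpt isOpen_univ (subset_univ _)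
  obtain ⟨L, hL⟩ := ContDiff.lipschitzWith_of_hasCompactSupport (𝕂 := ℝ)
    (f := fun x => φ x • field β x) hφc.smul_right (hφ.smul (contDiff_field β)) (by simp)
  obtain ⟨u₁, hu₁, hmin⟩ := hcpt.exists_isMinOn (hne.mono (self_subset_cthickening Γ))
    (contDiff_field β).continuous.norm.continuousOn
  have hκ : 0 < ‖field β u₁‖ := norm_field_pos (hrV hu₁)
  set κ := ‖field β u₁‖
  obtain ⟨B₀, hB₀⟩ := hcpt.exists_bound_of_continuousOn (contDiff_field β).continuous.continuousOn
  obtain ⟨B₁, hB₁⟩ := hcpt.exists_bound_of_continuousOn (contDiff_fieldC β).continuous.continuousOn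
  obtain ⟨B₂, hB₂⟩ := hcpt.exists_bound_of_continuousOn (contDiff_fieldH β).continuous.continuousOn
  have hB₀0 := (norm_nonneg _).trans (hB₀ _ hu₁)
  have hB₁0 := (norm_nonneg _).trans (hB₁ _ hu₁)
  have hB₂0 := (norm_nonneg _).trans (hB₂ _ hu₁)
  -- The first radius keeps the midpoint in the tube; the second makes the quadratic tangential
  -- error at most half of κ² d. Adding 1 keeps the denominator and A positive.
  refine ⟨min r (κ ^ 2 / (L * B₀ + 1)), lt_min hr (by positivity),
    2 * (B₁ + B₂ + 1) / κ ^ 2, by positivity, fun q hq => ?_⟩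
  obtain ⟨p, hpΓ, hp⟩ := hΓ.isCompact.exists_infDist_eq_dist hne q
  obtain ⟨s, rfl⟩ : p ∈ range γ := hΓ.orbit_eq_range ▸ hpΓ
  refine ⟨s, hp.symm, ?_⟩
  -- The nearest point minimises the squared distance along γ, so the displacement is orthogonal to
  -- the orbit.
  have horth : inner ℝ (field β (γ s)) (q - γ s) = 0 := by
    have hd : HasDerivAt (fun t => ‖q - γ t‖ ^ 2)
        (2 * inner ℝ (q - γ s) (-field β (γ s))) s := ((hΓ.solution s).const_sub q).norm_sq
    have hloc : IsLocalMin (fun t => ‖q - γ t‖ ^ 2) s := by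
      refine Eventually.of_forall fun t => ?_
      have : dist q (γ s) ≤ dist q (γ t) := hp ▸ infDist_le_dist_of_mem (hmem t)
      rw [dist_eq_norm, dist_eq_norm] at this
      exact pow_le_pow_left₀ (norm_nonneg _) this 2
    have := hloc.hasDerivAt_eq_zero hd
    rw [inner_neg_right, real_inner_comm] at this
    linarith
  set m : Space := (1 / 2 : ℝ) • (q + γ s) with hm
  have hms : m - γ s = (1 / 2 : ℝ) • (q - γ s) := by
    rw [hm]; module
  set d := dist q (γ s) with hd
  have hd0 : 0 ≤ d := dist_nonneg
  rw [hp, lt_min_iff, lt_div_iff₀ (by positivity)] at hq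
  have hdm : dist m (γ s) = d / 2 := by
    rw [dist_eq_norm, hms, norm_smul, ← dist_eq_norm, ← hd]
    norm_num; ring
  have hmK : m ∈ cthickening r Γ :=
    mem_cthickening_of_dist_le m (γ s) r Γ hpΓ (by rw [hdm]; linarith [hq.1])
  have hsK : γ s ∈ cthickening r Γ := self_subset_cthickening Γ hpΓ
  have hLip : ‖field β m - field β (γ s)‖ ≤ L * (d / 2) := by
    have := hL.dist_le_mul m (γ s)
    rwa [hdm, hφ1 m hmK, hφ1 _ hsK, one_smul, one_smul, dist_eq_norm] at this
  -- Orthogonality holds at γ s, not at the midpoint m; the Lipschitz bound over distance d / 2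
  -- makes the discrepancy quadratic in d.
  have hinner : |inner ℝ (field β m) (q - γ s)| ≤ L * (d / 2) * d := by
    have : inner ℝ (field β m) (q - γ s) =
        inner ℝ (field β m - field β (γ s)) (q - γ s) := by
      rw [inner_sub_left, horth, sub_zero]
    rw [this]
    refine (abs_real_inner_le_norm _ _).trans ?_
    rw [← dist_eq_norm q]
    exact mul_le_mul_of_nonneg_right hLip hd0
  have hkey := congrArg norm (norm_field_sq_smul_sub β q (γ s))
  rw [← hm, (hfiber hpΓ).1, (hfiber hpΓ).2, norm_smul, norm_pow, norm_norm, ← dist_eq_norm q,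
    ← hd] at hkey
  have h1 : ‖field β m‖ ^ 2 * d ≤ L * (d / 2) * d * B₀ + |H β q - h| * B₁ + |C q - c| * B₂ := by
    rw [hkey]
    refine (norm_sub_le _ _).trans (add_le_add ((norm_add_le _ _).trans (add_le_add ?_ ?_)) ?_)
    all_goals rw [norm_smul, Real.norm_eq_abs]
    · exact mul_le_mul hinner (hB₀ m hmK) (norm_nonneg _) (by positivity)
    · exact mul_le_mul_of_nonneg_left (hB₁ m hmK) (abs_nonneg _)
    · exact mul_le_mul_of_nonneg_left (hB₂ m hmK) (abs_nonneg _)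
  have h2 : κ ^ 2 * d ≤ ‖field β m‖ ^ 2 * d :=
    mul_le_mul_of_nonneg_right (pow_le_pow_left₀ hκ.le (hmin hmK) 2) hd0
  have h3 : L * (d / 2) * d * B₀ ≤ κ ^ 2 / 2 * d := by
    have : d * (L * B₀) ≤ κ ^ 2 := by linarith [hq.2]
    nlinarith
  have h4 : 0 ≤ |H β q - h| * (B₂ + 1) := by positivity
  have h5 : 0 ≤ |C q - c| * (B₁ + 1) := by positivity
  rw [div_mul_eq_mul_div, le_div_iff₀ (by positivity)]
  linarith

end Orbit

/-! ### Orbital stability, attraction and asymptotic phase. -/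

section Stability

open Rabinovich

variable {β h c : ℝ} {γ : ℝ → Space} {T : ℝ} {Γ : Set Space}

theorem Rabinovich.contDiffOn_perturbBoth {a b : Space → ℝ} (ha : ContDiffOn ℝ ∞ a (V β))
    (hb : ContDiffOn ℝ ∞ b (V β)) : ContDiffOn ℝ ∞ (perturbBoth β h c a b) (V β) := by
  unfold perturbBoth
  exact (((contDiff_field β).contDiffOn).sub
    ((ha.mul ((contDiff_H β).sub contDiff_const).contDiffOn).smul
      (contDiff_fieldC β).contDiffOn)).add
    ((hb.mul (contDiff_C.sub contDiff_const).contDiffOn).smul (contDiff_fieldH β).contDiffOn)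

/-- If `g` is positive on the compact set `s`, or if `f` starts at `0`, then a solution of
`f' = -g f` inside `s` decays with a rate that depends only on `s`. -/
theorem exists_decay_rate {E : Type*} [TopologicalSpace E] {s : Set E} (hs : IsCompact s)
    {g : E → ℝ} (hg : ContinuousOn g s) (hg0 : ∀ u ∈ s, 0 ≤ g u) {M : Set E} {F : E → ℝ}
    (hgM : (∀ u ∈ s, 0 < g u) ∨ ∀ u ∈ M, F u = 0) :
    ∃ l > 0, ∀ x : ℝ → E, x 0 ∈ M → (∀ t ≥ 0, x t ∈ s) →
      (∀ t ≥ 0, HasDerivAt (fun t => F (x t)) (-(g (x t) * F (x t))) t) →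
      ∀ t ≥ 0, |F (x t)| ≤ |F (x 0)| * Real.exp (-l * t) := by
  rcases hgM with hpos | hM
  · rcases s.eq_empty_or_nonempty with rfl | hne
    · exact ⟨1, one_pos, fun x _ hx => (hx 0 le_rfl).elim⟩
    · obtain ⟨u, hu, hmin⟩ := hs.exists_isMinOn hne hg
      exact ⟨g u, hpos u hu, fun x _ hx hd => abs_le_abs_mul_exp_of_hasDerivAt hd
        fun t ht => hmin (hx t ht)⟩
  · refine ⟨1, one_pos, fun x hx0 hx hd t ht => ?_⟩
    have := abs_le_abs_mul_exp_of_hasDerivAt (l := 0) hd (fun t ht => hg0 _ (hx t ht)) t ht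
    rw [hM _ hx0, abs_zero, zero_mul] at this ⊢
    exact this

/-- One statement covers all the stable cases: each integral either decays, its coefficient being
positive, or already has the right value on M, in which case the coefficient may vanish. -/
theorem IsPeriodicOrbit.orbitallyPhaseAsymptoticallyStable_perturbBoth
    (hΓ : IsPeriodicOrbit (field β) univ γ T Γ)
    (hfiber : Γ ⊆ {u | H β u = h ∧ C u = c}) {a b : Space → ℝ}
    (ha : ContDiffOn ℝ ∞ a (V β)) (hb : ContDiffOn ℝ ∞ b (V β))
    (ha0 : ∀ u ∈ V β, 0 ≤ a u) (hb0 : ∀ u ∈ V β, 0 ≤ b u) {M : Set Space}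
    (haM : (∀ u ∈ V β, 0 < a u) ∨ ∀ u ∈ M, H β u = h)
    (hbM : (∀ u ∈ V β, 0 < b u) ∨ ∀ u ∈ M, C u = c) :
    OrbitallyPhaseAsymptoticallyStable (perturbBoth β h c a b) (V β) M γ Γ := by
  have hmem : ∀ t, γ t ∈ Γ := fun t => by rw [hΓ.orbit_eq_range]; exact mem_range_self t
  have hne : Γ.Nonempty := ⟨_, hmem 0⟩
  have hΓV : Γ ⊆ V β := by
    rw [hΓ.orbit_eq_range]; exact range_subset_iff.2 hΓ.mem_V
  obtain ⟨r, hr, hrV⟩ := hΓ.isCompact.exists_cthickening_subset_open (isOpen_V β) hΓV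
  set k := cthickening r Γ with hk
  have hcpt : IsCompact k := hΓ.isCompact.cthickening
  have hΓk : Γ ⊆ k := self_subset_cthickening Γ
  -- The cut-off system w is complete and agrees with the perturbed one on the tube k; its solutions
  -- solve the original system once they are shown to stay in k.
  obtain ⟨φ, hφ, hφc, hφV, hφ1, hφ0⟩ := exists_contDiff_cutoff hcpt (isOpen_V β) hrV
  set v : Space → Space := fun u => φ u • field β u with hv
  set w : Space → Space := fun u => φ u • perturbBoth β h c a b u with hw
  obtain ⟨L, hL⟩ := ContDiff.lipschitzWith_of_hasCompactSupport (𝕂 := ℝ)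
    (f := v) hφc.smul_right (hφ.smul (contDiff_field β)) (by simp)
  have hwdiff : ContDiff ℝ ∞ w :=
    (contDiffOn_perturbBoth ha hb).contDiff_smul_cutoff (isOpen_V β) hφ hφV
  have hwc : HasCompactSupport w := hφc.smul_right
  obtain ⟨Lw, hLw⟩ := ContDiff.lipschitzWith_of_hasCompactSupport (𝕂 := ℝ) hwc hwdiff (by simp)
  obtain ⟨Bw, hBw⟩ := hwc.exists_bound_of_continuous hwdiff.continuous
  have hsol : ∀ x₀, ∃ x : ℝ → Space, x 0 = x₀ ∧ ∀ t, HasDerivAt x (w (x t)) t :=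
    exists_hasDerivAt_of_lipschitzWith_of_bounded hLw (L := Real.toNNReal Bw)
      fun x => (hBw x).trans (Real.le_coe_toNNReal _)
  -- evolution of the two integrals
  have hw_eq : ∀ u, w u = (φ u * 1) • field β u +
      (φ u * (-(a u * (H β u - h)))) • fieldC β u + (φ u * (b u * (C u - c))) • fieldH β u := by
    intro u
    rw [hw]
    simp only [perturbBoth_eq, smul_add, smul_smul]
  have hHd : ∀ x : ℝ → Space, (∀ t, HasDerivAt x (w (x t)) t) → ∀ t,
      HasDerivAt (fun t => H β (x t) - h)
        (-((φ (x t) * a (x t) * ‖field β (x t)‖ ^ 2) * (H β (x t) - h))) t := by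
    intro x hx t
    have h1 := (hx t).hasDerivWithinAt (s := univ)
    rw [hw_eq] at h1
    refine ((hasDerivWithinAt_H_of_combination h1).hasDerivAt univ_mem).sub_const h
      |>.congr_deriv ?_
    ring
  have hCd : ∀ x : ℝ → Space, (∀ t, HasDerivAt x (w (x t)) t) → ∀ t,
      HasDerivAt (fun t => C (x t) - c)
        (-((φ (x t) * b (x t) * ‖field β (x t)‖ ^ 2) * (C (x t) - c))) t := by
    intro x hx t
    have h1 := (hx t).hasDerivWithinAt (s := univ)
    rw [hw_eq] at h1
    refine ((hasDerivWithinAt_C_of_combination h1).hasDerivAt univ_mem).sub_const c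
      |>.congr_deriv ?_
    ring
  -- Nothing is known about f outside V, but φ vanishes there. Hence both errors are nonincreasing
  -- along w everywhere, before any trapping is known.
  have hφpos : ∀ f : Space → ℝ, (∀ u ∈ V β, 0 ≤ f u) → ∀ u, 0 ≤ φ u * f u * ‖field β u‖ ^ 2 := by
    intro f hf u
    refine mul_nonneg ?_ (sq_nonneg _)
    by_cases hu : u ∈ V β
    · exact mul_nonneg (hφ0 u) (hf u hu)
    · rw [image_eq_zero_of_notMem_tsupport fun h => hu (hφV h), zero_mul]
  set e : Space → ℝ := fun u => |H β u - h| + |C u - c| with he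
  have hemono : ∀ x : ℝ → Space, (∀ t, HasDerivAt x (w (x t)) t) → ∀ t ≥ 0,
      e (x t) ≤ e (x 0) := by
    intro x hx t ht
    have h1 := abs_le_abs_mul_exp_of_hasDerivAt (l := 0) (fun t _ => hHd x hx t)
      (fun t _ => hφpos a ha0 (x t)) t ht
    have h2 := abs_le_abs_mul_exp_of_hasDerivAt (l := 0) (fun t _ => hCd x hx t)
      (fun t _ => hφpos b hb0 (x t)) t ht
    simp only [neg_zero, zero_mul, Real.exp_zero, mul_one] at h1 h2
    exact add_le_add h1 h2
  have hecont : Continuous e :=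
    ((contDiff_H β).continuous.sub continuous_const).abs.add
      (contDiff_C.continuous.sub continuous_const).abs
  -- trapping
  obtain ⟨δ₁, hδ₁, A, hA, hdist⟩ := hΓ.exists_dist_le_integrals hfiber
  have htrap : ∀ ε > 0, ∃ δ > 0, ∀ x : ℝ → Space, (∀ t, HasDerivAt x (w (x t)) t) →
      infDist (x 0) Γ < δ → ∀ t ≥ 0, infDist (x t) Γ < ε := by
    intro ε hε
    -- Half of δ₁ leaves the strict gap η < δ₁ that the trapping argument needs.
    set η := min ε (δ₁ / 2) with hη
    have hη0 : 0 < η := lt_min hε (by positivity)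
    have hηδ : η < δ₁ := (min_le_right _ _).trans_lt (by linarith)
    have hopen : IsOpen {u | A * e u < η} :=
      isOpen_lt (continuous_const.mul hecont) continuous_const
    have hsub : Γ ⊆ {u | A * e u < η} := fun u hu => by
      have := hfiber hu
      simp only [mem_ofPred_eq, he] at this ⊢
      simpa [this.1, this.2] using hη0
    obtain ⟨δ, hδ, hδsub⟩ := hΓ.isCompact.exists_thickening_subset_open hopen hsub
    refine ⟨min δ η, lt_min hδ hη0, fun x hx hx0 t ht => ?_⟩
    rw [lt_min_iff] at hx0
    have he0 : A * e (x 0) < η := hδsub ((mem_thickening_iff_infDist_lt hne).2 hx0.1)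
    refine (forall_infDist_lt_of_trapping (fun t => (hx t).continuousAt) hηδ hx0.2
      (fun t ht hlt => ?_) t ht).trans_le (min_le_left _ _)
    obtain ⟨s, hs1, hs2⟩ := hdist (x t) hlt
    rw [← hs1]
    exact (hs2.trans (mul_le_mul_of_nonneg_left (hemono x hx t ht) hA.le)).trans_lt he0
  have hforward : ∀ x : ℝ → Space, (∀ t, HasDerivAt x (w (x t)) t) → (∀ t ≥ 0, x t ∈ k) →
      IsForwardSolution (perturbBoth β h c a b) (V β) (x 0) x := by
    intro x hx hxk
    refine ⟨rfl, fun t ht => ⟨hrV (hxk t ht), ?_⟩⟩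
    have hwt : w (x t) = perturbBoth β h c a b (x t) := by
      simp only [hw, hφ1 _ (hxk t ht), one_smul]
    exact hwt ▸ (hx t).hasDerivWithinAt
  have hink : ∀ u, infDist u Γ < r → u ∈ k := fun u hu =>
    thickening_subset_cthickening _ _ ((mem_thickening_iff_infDist_lt hne).2 hu)
  have hstable : OrbitallyStable (perturbBoth β h c a b) (V β) M Γ := by
    intro ε hε
    obtain ⟨δ, hδ, H⟩ := htrap (min ε r) (lt_min hε hr)
    refine ⟨δ, hδ, fun x₀ _ hx₀ => ?_⟩
    obtain ⟨x, rfl, hx⟩ := hsol x₀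
    have := H x hx hx₀
    exact ⟨x, hforward x hx fun t ht => hink _ ((this t ht).trans_le (min_le_right _ _)),
      fun t ht => (this t ht.le).trans_le (min_le_left _ _)⟩
  -- attraction
  have hspeed : ∀ u ∈ k, 0 < φ u * ‖field β u‖ ^ 2 := fun u hu => by
    have := norm_field_pos (hrV hu)
    rw [hφ1 u hu]; positivity
  have hrate : ∀ {f F : Space → ℝ}, ContDiffOn ℝ ∞ f (V β) → (∀ u ∈ V β, 0 ≤ f u) →
      ((∀ u ∈ V β, 0 < f u) ∨ ∀ u ∈ M, F u = 0) → ∃ l > 0, ∀ x : ℝ → Space, x 0 ∈ M →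
      (∀ t ≥ 0, x t ∈ k) → (∀ t ≥ 0, HasDerivAt (fun t => F (x t))
        (-((φ (x t) * f (x t) * ‖field β (x t)‖ ^ 2) * F (x t))) t) →
      ∀ t ≥ 0, |F (x t)| ≤ |F (x 0)| * Real.exp (-l * t) := by
    intro f F hf hf0 hfM
    refine exists_decay_rate hcpt (g := fun u => φ u * f u * ‖field β u‖ ^ 2) ?_
      (fun u _ => hφpos f hf0 u) (hfM.imp_left fun hpos u hu => ?_)
    · exact (hφ.continuous.continuousOn.mul (hf.continuousOn.mono hrV)).mul
        ((contDiff_field β).continuous.norm.pow 2).continuousOn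
    · nlinarith [mul_pos (hspeed u hu) (hpos u (hrV hu))]
  obtain ⟨l₁, hl₁, hdec₁⟩ := hrate (F := fun u => H β u - h) ha ha0
    (haM.imp_right fun hM u hu => sub_eq_zero.2 (hM u hu))
  obtain ⟨l₂, hl₂, hdec₂⟩ := hrate (F := fun u => C u - c) hb hb0
    (hbM.imp_right fun hM u hu => sub_eq_zero.2 (hM u hu))
  set l := min l₁ l₂ with hl
  have hl0 : 0 < l := lt_min hl₁ hl₂
  have hedec : ∀ x : ℝ → Space, (∀ t, HasDerivAt x (w (x t)) t) → x 0 ∈ M →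
      (∀ t ≥ 0, x t ∈ k) → ∀ t ≥ 0, e (x t) ≤ e (x 0) * Real.exp (-l * t) := by
    intro x hx hx0 hxk t ht
    have h1 := hdec₁ x hx0 hxk (fun t _ => hHd x hx t) t ht
    have h2 := hdec₂ x hx0 hxk (fun t _ => hCd x hx t) t ht
    have h3 : Real.exp (-l₁ * t) ≤ Real.exp (-l * t) := by
      refine Real.exp_le_exp.2 (mul_le_mul_of_nonneg_right ?_ ht)
      linarith [min_le_left l₁ l₂]
    have h4 : Real.exp (-l₂ * t) ≤ Real.exp (-l * t) := by
      refine Real.exp_le_exp.2 (mul_le_mul_of_nonneg_right ?_ ht)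
      linarith [min_le_right l₁ l₂]
    calc e (x t) ≤ |H β (x 0) - h| * Real.exp (-l * t) + |C (x 0) - c| * Real.exp (-l * t) :=
          add_le_add (h1.trans (mul_le_mul_of_nonneg_left h3 (abs_nonneg _)))
            (h2.trans (mul_le_mul_of_nonneg_left h4 (abs_nonneg _)))
      _ = e (x 0) * Real.exp (-l * t) := by rw [← add_mul]
  -- size of the perturbation
  obtain ⟨B₁, hB₁⟩ := hcpt.exists_bound_of_continuousOn
    ((ha.continuousOn.mono hrV).smul (contDiff_fieldC β).continuous.continuousOn)
  obtain ⟨B₂, hB₂⟩ := hcpt.exists_bound_of_continuousOn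
    ((hb.continuousOn.mono hrV).smul (contDiff_fieldH β).continuous.continuousOn)
  have hB₁0 := (norm_nonneg _).trans (hB₁ _ (hΓk (hmem 0)))
  have hB₂0 := (norm_nonneg _).trans (hB₂ _ (hΓk (hmem 0)))
  have hpert : ∀ u ∈ k, dist (w u) (v u) ≤ (B₁ + B₂) * e u := by
    intro u hu
    have h1 : w u - v u = -((H β u - h) • (a u • fieldC β u)) +
        (C u - c) • (b u • fieldH β u) := by
      simp only [hw, hv, hφ1 u hu, one_smul, perturbBoth]
      module
    rw [dist_eq_norm, h1]
    refine (norm_add_le _ _).trans ?_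
    rw [norm_neg, norm_smul (H β u - h), norm_smul (C u - c), Real.norm_eq_abs, Real.norm_eq_abs]
    have h2 : _ * ‖a u • fieldC β u‖ ≤ _ :=
      mul_le_mul_of_nonneg_left (hB₁ u hu) (abs_nonneg (H β u - h))
    have h3 : _ * ‖b u • fieldH β u‖ ≤ _ :=
      mul_le_mul_of_nonneg_left (hB₂ u hu) (abs_nonneg (C u - c))
    have h4 : 0 ≤ |H β u - h| * B₂ := by positivity
    have h5 : 0 ≤ |C u - c| * B₁ := by positivity
    simp only [he]
    linarith
  obtain ⟨δ, hδ, hδtrap⟩ := htrap (min r δ₁) (lt_min hr hδ₁)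
  have hattract : ∀ x : ℝ → Space, (∀ t, HasDerivAt x (w (x t)) t) → x 0 ∈ M →
      infDist (x 0) Γ < δ → IsForwardSolution (perturbBoth β h c a b) (V β) (x 0) x ∧
      (∀ t ≥ 0, infDist (x t) Γ ≤ A * e (x 0) * Real.exp (-l * t)) ∧
      ∃ θ, Tendsto (fun t => ‖x t - γ (t + θ)‖) atTop (𝓝 0) := by
    intro x hx hx0 hx0δ
    have hxr := hδtrap x hx hx0δ
    have hxk : ∀ t ≥ 0, x t ∈ k := fun t ht => hink _ ((hxr t ht).trans_le (min_le_left _ _))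
    have hexp := hedec x hx hx0 hxk
    have hdist' : ∀ t ≥ 0, ∃ s, dist (x t) (γ s) = infDist (x t) Γ ∧
        dist (x t) (γ s) ≤ A * e (x 0) * Real.exp (-l * t) := fun t ht => by
      obtain ⟨s, hs1, hs2⟩ := hdist (x t) ((hxr t ht).trans_le (min_le_right _ _))
      refine ⟨s, hs1, hs2.trans ?_⟩
      rw [mul_assoc]
      exact mul_le_mul_of_nonneg_left (hexp t ht) hA.le
    have he0 : 0 ≤ e (x 0) := by positivity
    refine ⟨hforward x hx hxk, fun t ht => ?_, ?_⟩
    · obtain ⟨s, hs1, hs2⟩ := hdist' t ht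
      rwa [← hs1]
    -- A single constant must dominate both the distance to Γ (factor A) and the deviation of w from
    -- the cut-off Rabinovich field (factor B₁ + B₂).
    · refine exists_asymptotic_phase hL (x' := fun t => w (x t))
        (A := (A + (B₁ + B₂)) * e (x 0)) hΓ.period_pos hl0 hΓ.periodic
        (fun t => ?_) (fun t _ => hx t) (fun t ht => ?_) fun t ht => ?_
      · simpa [hv, hφ1 _ (hΓk (hmem t))] using hΓ.solution t
      · refine (hpert _ (hxk t ht)).trans ?_
        have h1 := mul_le_mul_of_nonneg_left (hexp t ht) (add_nonneg hB₁0 hB₂0)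
        have h2 : 0 ≤ A * e (x 0) * Real.exp (-l * t) := by positivity
        linarith
      · obtain ⟨s, -, hs⟩ := hdist' t ht
        refine ⟨s, hs.trans ?_⟩
        have : 0 ≤ (B₁ + B₂) * e (x 0) * Real.exp (-l * t) := by positivity
        linarith
  refine ⟨⟨hstable, δ, hδ, fun x₀ hx₀ hx₀δ => ?_⟩, δ, hδ, fun x₀ hx₀ hx₀δ => ?_⟩
  · obtain ⟨x, rfl, hx⟩ := hsol x₀
    obtain ⟨hfor, hlim, -⟩ := hattract x hx hx₀.2 hx₀δ
    refine ⟨x, hfor, ?_⟩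
    have h0 : Tendsto (fun t : ℝ => A * e (x 0) * Real.exp (-l * t)) atTop
        (𝓝 (A * e (x 0) * 0)) :=
      (Real.tendsto_exp_atBot.comp (tendsto_id.const_mul_atTop_of_neg (by linarith))).const_mul _
    rw [mul_zero] at h0
    exact squeeze_zero' (Eventually.of_forall fun _ => infDist_nonneg)
      ((eventually_ge_atTop 0).mono hlim) h0
  · obtain ⟨x, rfl, hx⟩ := hsol x₀
    obtain ⟨hfor, -, hphase⟩ := hattract x hx hx₀.2 hx₀δ
    exact ⟨x, hfor, hphase⟩

end Stability

/-! ### Off-level initial points and instability. -/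

section Instability

open Rabinovich

variable {β h c : ℝ} {γ : ℝ → Space} {T : ℝ} {Γ : Set Space}

/-- Along a vector field `P` through `p` that keeps `G` constant and increases or decreases `F`
to first order, there are points near `p` on the level of `G` and off the level of `F`. -/
theorem exists_level_ne {E : Type*} [NormedAddCommGroup E] [NormedSpace ℝ E] [CompleteSpace E]
    {P : E → E} {p : E} (hP : ContDiffAt ℝ 1 P p) {F G : E → ℝ} {κ : ℝ} (hκ : κ ≠ 0)
    (hF : ∀ (y : ℝ → E), y 0 = p → HasDerivAt y (P p) 0 → HasDerivAt (fun t => F (y t)) κ 0)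
    (hG : ∀ (y : ℝ → E) (t : ℝ), HasDerivAt y (P (y t)) t → HasDerivAt (fun t => G (y t)) 0 t)
    {U : Set E} (hU : U ∈ 𝓝 p) : ∃ u ∈ U, G u = G p ∧ F u ≠ F p := by
  obtain ⟨y, hy0, ε, hε, hy⟩ :=
    hP.exists_forall_mem_closedBall_exists_eq_forall_mem_Ioo_hasDerivAt₀ 0
  rw [zero_sub, zero_add] at hy
  have h0 : (0 : ℝ) ∈ Ioo (-ε) ε := ⟨by linarith, hε⟩
  have hd := hy 0 h0
  rw [hy0] at hd
  have hne : ∀ᶠ t in 𝓝[≠] (0 : ℝ), F (y t) ≠ F p := (hF y hy0 hd).eventually_ne hκ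
  have hyU : ∀ᶠ t in 𝓝[≠] (0 : ℝ), y t ∈ U :=
    nhdsWithin_le_nhds (hd.continuousAt.eventually_mem (by rwa [hy0]))
  have hI : ∀ᶠ t in 𝓝[≠] (0 : ℝ), t ∈ Ioo (-ε) ε :=
    nhdsWithin_le_nhds (Ioo_mem_nhds h0.1 h0.2)
  obtain ⟨t, h1, h2, h3⟩ := (hne.and (hyU.and hI)).exists
  refine ⟨y t, h2, ?_, h1⟩
  have := (convex_Ioo (-ε) ε).norm_image_sub_le_of_norm_hasDerivWithin_le
    (f := fun t => G (y t)) (f' := fun _ => 0) (C := 0)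
    (fun s hs => (hG y s (hy s hs)).hasDerivWithinAt) (by simp) h0 h3
  simpa [sub_eq_zero, hy0] using this

/-- Flow along P = ∇C × X: it preserves C and changes H at the rate |X|², which is positive on V. -/
theorem Rabinovich.exists_C_eq_H_ne {p : Space} (hp : p ∈ V β) {U : Set Space} (hU : U ∈ 𝓝 p) :
    ∃ u ∈ U, C u = C p ∧ H β u ≠ H β p := by
  have hcomb : ∀ u : Space, fieldC β u =
      (0 : ℝ) • field β u + (1 : ℝ) • fieldC β u + (0 : ℝ) • fieldH β u := fun u => by simp
  refine exists_level_ne (P := fieldC β) ((contDiff_fieldC β).of_le (by simp)).contDiffAt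
    (κ := ‖field β p‖ ^ 2) (pow_pos (norm_field_pos hp) 2).ne' (fun y hy0 hy => ?_)
    (fun y t hy => ?_) hU
  · have h1 := hy.hasDerivWithinAt (s := univ)
    rw [hcomb, ← hy0] at h1
    simpa [hy0] using hasDerivWithinAt_H_of_combination h1
  · have h1 := hy.hasDerivWithinAt (s := univ)
    rw [hcomb] at h1
    simpa using hasDerivWithinAt_C_of_combination h1

/-- Flow along Q = ∇H × X: it preserves H and changes C at the rate -|X|². -/
theorem Rabinovich.exists_H_eq_C_ne {p : Space} (hp : p ∈ V β) {U : Set Space} (hU : U ∈ 𝓝 p) :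
    ∃ u ∈ U, H β u = H β p ∧ C u ≠ C p := by
  have hcomb : ∀ u : Space, fieldH β u =
      (0 : ℝ) • field β u + (0 : ℝ) • fieldC β u + (1 : ℝ) • fieldH β u := fun u => by simp
  refine exists_level_ne (P := fieldH β) ((contDiff_fieldH β).of_le (by simp)).contDiffAt
    (κ := -‖field β p‖ ^ 2) (neg_ne_zero.2 (pow_pos (norm_field_pos hp) 2).ne')
    (fun y hy0 hy => ?_) (fun y t hy => ?_) hU
  · have h1 := hy.hasDerivWithinAt (s := univ)
    rw [hcomb, ← hy0] at h1
    simpa [hy0] using hasDerivWithinAt_C_of_combination h1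
  · have h1 := hy.hasDerivWithinAt (s := univ)
    rw [hcomb] at h1
    simpa using hasDerivWithinAt_H_of_combination h1

theorem IsPeriodicOrbit.orbitallyUnstable_perturbCPlus
    (hΓ : IsPeriodicOrbit (field β) univ γ T Γ)
    (hfiber : Γ ⊆ {u | H β u = h ∧ C u = c}) {a : Space → ℝ} (ha : SmoothPos β a) :
    OrbitallyUnstable (perturbCPlus β h a) (V β) {u | C u = c} Γ := by
  have hmem : γ 0 ∈ Γ := by rw [hΓ.orbit_eq_range]; exact mem_range_self 0
  have hfib := hfiber hmem
  refine .of_hasDerivWithinAt (f := fun u => H β u - h) (μ := fun u => a u * ‖field β u‖ ^ 2)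
    hΓ.isCompact ⟨_, hmem⟩ (isOpen_V β) ?_ ?_ ?_ (fun u hu => ?_) (fun x t _ hx => ?_)
    fun δ hδ => ?_
  · rw [hΓ.orbit_eq_range]; exact range_subset_iff.2 hΓ.mem_V
  · exact ((contDiff_H β).continuous.sub continuous_const).continuousOn
  · exact ha.1.continuousOn.mul ((contDiff_field β).continuous.norm.pow 2).continuousOn
  · exact mul_pos (ha.2 u hu) (pow_pos (norm_field_pos hu) 2)
  · rw [perturbCPlus_eq_perturbBoth β h c, perturbBoth_eq] at hx
    refine ((hasDerivWithinAt_H_of_combination hx).sub_const h).congr_deriv ?_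
    simp only [Pi.neg_apply]; ring
  · obtain ⟨u, ⟨hu, huV⟩, hC, hH⟩ := exists_C_eq_H_ne (hΓ.mem_V 0)
      (inter_mem (ball_mem_nhds (γ 0) hδ) ((isOpen_V β).mem_nhds (hΓ.mem_V 0)))
    refine ⟨u, ⟨huV, hC.trans hfib.2⟩, (infDist_le_dist_of_mem hmem).trans_lt hu, ?_⟩
    rw [← hfib.1]; exact sub_ne_zero.2 hH

theorem IsPeriodicOrbit.orbitallyUnstable_perturbHMinus
    (hΓ : IsPeriodicOrbit (field β) univ γ T Γ)
    (hfiber : Γ ⊆ {u | H β u = h ∧ C u = c}) {b : Space → ℝ} (hb : SmoothPos β b) :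
    OrbitallyUnstable (perturbHMinus β c b) (V β) {u | H β u = h} Γ := by
  have hmem : γ 0 ∈ Γ := by rw [hΓ.orbit_eq_range]; exact mem_range_self 0
  have hfib := hfiber hmem
  refine .of_hasDerivWithinAt (f := fun u => C u - c) (μ := fun u => b u * ‖field β u‖ ^ 2)
    hΓ.isCompact ⟨_, hmem⟩ (isOpen_V β) ?_ ?_ ?_ (fun u hu => ?_) (fun x t _ hx => ?_)
    fun δ hδ => ?_
  · rw [hΓ.orbit_eq_range]; exact range_subset_iff.2 hΓ.mem_V
  · exact (contDiff_C.continuous.sub continuous_const).continuousOn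
  · exact hb.1.continuousOn.mul ((contDiff_field β).continuous.norm.pow 2).continuousOn
  · exact mul_pos (hb.2 u hu) (pow_pos (norm_field_pos hu) 2)
  · rw [perturbHMinus_eq_perturbBoth β h c, perturbBoth_eq] at hx
    refine ((hasDerivWithinAt_C_of_combination hx).sub_const c).congr_deriv ?_
    simp only [Pi.neg_apply]; ring
  · obtain ⟨u, ⟨hu, huV⟩, hH, hC⟩ := exists_H_eq_C_ne (hΓ.mem_V 0)
      (inter_mem (ball_mem_nhds (γ 0) hδ) ((isOpen_V β).mem_nhds (hΓ.mem_V 0)))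
    refine ⟨u, ⟨huV, hH.trans hfib.1⟩, (infDist_le_dist_of_mem hmem).trans_lt hu, ?_⟩
    rw [← hfib.2]; exact sub_ne_zero.2 hC

end Instability

/-! ### Assembly of the five systems. -/

theorem mainTheorem2 (β h c : ℝ) (γ : ℝ → Rabinovich.Space) (T : ℝ) (Γ : Set Rabinovich.Space)
    (hΓ : IsPeriodicOrbit (Rabinovich.field β) Set.univ γ T Γ)
    (hfiber : Γ ⊆ {u | Rabinovich.H β u = h ∧ Rabinovich.C u = c}) :
    (∀ a : Rabinovich.Space → ℝ, Rabinovich.SmoothPos β a →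
      (IsPeriodicOrbit (Rabinovich.perturbCMinus β h a) (Rabinovich.V β) γ T Γ ∧
        IsConstantOfMotion (Rabinovich.perturbCMinus β h a) (Rabinovich.V β) Rabinovich.C ∧
        OrbitallyPhaseAsymptoticallyStable (Rabinovich.perturbCMinus β h a) (Rabinovich.V β) {u | Rabinovich.C u = c} γ Γ) ∧
      (IsPeriodicOrbit (Rabinovich.perturbCPlus β h a) (Rabinovich.V β) γ T Γ ∧
        IsConstantOfMotion (Rabinovich.perturbCPlus β h a) (Rabinovich.V β) Rabinovich.C ∧
        OrbitallyUnstable (Rabinovich.perturbCPlus β h a) (Rabinovich.V β) {u | Rabinovich.C u = c} Γ ∧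
        OrbitallyUnstable (Rabinovich.perturbCPlus β h a) (Rabinovich.V β) Set.univ Γ)) ∧
    (∀ a : Rabinovich.Space → ℝ, Rabinovich.SmoothPos β a →
      (IsPeriodicOrbit (Rabinovich.perturbHPlus β c a) (Rabinovich.V β) γ T Γ ∧
        IsConstantOfMotion (Rabinovich.perturbHPlus β c a) (Rabinovich.V β) (Rabinovich.H β) ∧
        OrbitallyPhaseAsymptoticallyStable (Rabinovich.perturbHPlus β c a) (Rabinovich.V β) {u | Rabinovich.H β u = h} γ Γ) ∧
      (IsPeriodicOrbit (Rabinovich.perturbHMinus β c a) (Rabinovich.V β) γ T Γ ∧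
        IsConstantOfMotion (Rabinovich.perturbHMinus β c a) (Rabinovich.V β) (Rabinovich.H β) ∧
        OrbitallyUnstable (Rabinovich.perturbHMinus β c a) (Rabinovich.V β) {u | Rabinovich.H β u = h} Γ ∧
        OrbitallyUnstable (Rabinovich.perturbHMinus β c a) (Rabinovich.V β) Set.univ Γ)) ∧
    (∀ a b : Rabinovich.Space → ℝ, Rabinovich.SmoothPos β a → Rabinovich.SmoothPos β b →
        IsPeriodicOrbit (Rabinovich.perturbBoth β h c a b) (Rabinovich.V β) γ T Γ ∧
        OrbitallyPhaseAsymptoticallyStable (Rabinovich.perturbBoth β h c a b) (Rabinovich.V β) Set.univ γ Γ) := by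
  have hzero : ContDiffOn ℝ ∞ (0 : Rabinovich.Space → ℝ) (Rabinovich.V β) := contDiffOn_const
  refine ⟨fun a ha => ⟨?_, ?_⟩, fun b hb => ⟨?_, ?_⟩, fun a b ha hb => ⟨?_, ?_⟩⟩
  · rw [Rabinovich.perturbCMinus_eq_perturbBoth β h c]
    exact ⟨hΓ.isPeriodicOrbit_perturbBoth hfiber _ _, Rabinovich.isConstantOfMotion_C _ _ _ _,
      -- With b = 0 the error C - c does not decay, but it is zero on the level set from the start.
      hΓ.orbitallyPhaseAsymptoticallyStable_perturbBoth hfiber ha.1 hzero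
        (fun u hu => (ha.2 u hu).le) (fun _ _ => le_rfl) (Or.inl ha.2) (Or.inr fun _ hu => hu)⟩
  -- Unstable initial points on the level set also lie in V, so instability along the level set
  -- gives instability in V.
  · have hunst := hΓ.orbitallyUnstable_perturbCPlus hfiber ha
    refine ⟨?_, ?_, hunst, hunst.mono (Set.subset_univ _)⟩ <;>
      rw [Rabinovich.perturbCPlus_eq_perturbBoth β h c]
    · exact hΓ.isPeriodicOrbit_perturbBoth hfiber _ _
    · exact Rabinovich.isConstantOfMotion_C _ _ _ _
  · rw [Rabinovich.perturbHPlus_eq_perturbBoth β h c]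
    exact ⟨hΓ.isPeriodicOrbit_perturbBoth hfiber _ _, Rabinovich.isConstantOfMotion_H _ _ _ _,
      hΓ.orbitallyPhaseAsymptoticallyStable_perturbBoth hfiber hzero hb.1
        (fun _ _ => le_rfl) (fun u hu => (hb.2 u hu).le) (Or.inr fun _ hu => hu) (Or.inl hb.2)⟩
  · have hunst := hΓ.orbitallyUnstable_perturbHMinus hfiber hb
    refine ⟨?_, ?_, hunst, hunst.mono (Set.subset_univ _)⟩ <;>
      rw [Rabinovich.perturbHMinus_eq_perturbBoth β h c]
    · exact hΓ.isPeriodicOrbit_perturbBoth hfiber _ _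
    · exact Rabinovich.isConstantOfMotion_H _ _ _ _
  · exact hΓ.isPeriodicOrbit_perturbBoth hfiber _ _
  · exact hΓ.orbitallyPhaseAsymptoticallyStable_perturbBoth hfiber ha.1 hb.1
      (fun u hu => (ha.2 u hu).le) (fun u hu => (hb.2 u hu).le) (Or.inl ha.2) (Or.inl hb.2)
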